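/- A surface is a Hausdorff 2-manifold $\Sigma$ without boundary, possibly non-compact or non-orientable. An embedding $g$ of a locally finite simple graph $G$ into $\Sigma$ is an injective map from the 1-complex of $G$ to $\Sigma$ whose restriction to each finite subgraph is a homeomorphism onto its image. It is generous if every vertex $v$ has an open topological disc $D_v\subset\Sigma$ with $D_v\cap g(V(G))=\{g(v)\}$ that avoids $g(e)$ for every edge $e$ not incident with $v$, and every edge $e=uv$ has an open topological disc $D_e\subset\Sigma$ with $D_e\cap g(G)=g(e)\setminus\{g(u),g(v)\}$. Given a generous embedding $g$ with such discs, the fattening $F(G)$ is the following simple graph. For each edge $e=uv$ of $G$, add two new vertices $t_1,t_2$ (the tips of $e$), each joined to both $u$ and $v$, and draw the square $Q_e=u\,t_1\,v\,t_2$ so that $Q_e\setminus\{u,v\}\subset D_e$ and so that $Q_e$ bounds an open disc contained in $D_e$ that contains $g(e)\setminus\{g(u),g(v)\}$; do this for all edges so that an embedding into $\Sigma$ of $G$ together with all the squares results. Then, for every $v\in V(G)$ and any two distinct tips $t,s$ adjacent to $v$ such that the edges $vt$ and $vs$ are consecutive in the cyclic order in which the edges of this embedded graph leave $v$, join $t$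 and $s$ by an edge. Theorem. Let $G$ be a connected, locally finite simple graph with at least two vertices, generously embedded in a surface $\Sigma$. Then every fattening $F(G)$ obtained in this way is 3-connected, that is, it has more than three vertices and remains connected after the deletion of any set of at most two vertices. -/

import Mathlib

open scoped unitInterval Topology

namespace SurfaceGraph

/-- A simple graph is `k`-connected if it has more than `k` vertices and no set of fewer than `k`
vertices separates it. -/
def IsKConnected {W : Type*} (k : ℕ) (K : SimpleGraph W) : Prop :=
  (k : ℕ∞) < ENat.card W ∧
    ∀ X : Finset W, X.card < k → (K.induce {w | w ∉ X}).Connected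

/-- A topological open disc in `S`: an open subset homeomorphic to the plane
(equivalently, to the open unit disc). -/
def IsOpenDisc {S : Type*} [TopologicalSpace S] (D : Set S) : Prop :=
  ∃ φ : ℂ → S, Topology.IsOpenEmbedding φ ∧ Set.range φ = D

/-- An embedding of (the 1-complex of) a simple graph into a space: vertices go to distinct points,
edges go to arcs (one parametrisation for each orientation), and the resulting map on the
1-complex is injective. For a Hausdorff target, its restriction to every finite subgraph is then a
homeomorphism onto its image, by compactness. -/
structure Embedding {W : Type*} (K : SimpleGraph W) (S : Type*) [TopologicalSpace S] where
  /-- the image of a vertex -/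
  point : W → S
  /-- the image of an edge, parametrised from its first to its second end-vertex -/
  arc : (d : K.Dart) → Path (point d.fst) (point d.snd)
  arc_symm : ∀ (d : K.Dart) (t : I), arc d.symm t = arc d (σ t)
  point_injective : Function.Injective point
  arc_injective : ∀ d : K.Dart, Function.Injective (arc d)
  /-- no vertex lies in the interior of an edge -/
  eq_endpoint_of_arc_eq_point : ∀ (d : K.Dart) (t : I) (w : W),
    arc d t = point w → t = 0 ∨ t = 1
  /-- the interior of an edge meets no other edge -/
  eq_endpoint_of_arc_eq_arc : ∀ (d d' : K.Dart) (t t' : I),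
    d.edge ≠ d'.edge → arc d t = arc d' t' → t = 0 ∨ t = 1

namespace Embedding

variable {W : Type*} {K : SimpleGraph W} {S : Type*} [TopologicalSpace S]

/-- The image of the whole graph. -/
def image (f : Embedding K S) : Set S :=
  Set.range f.point ∪ ⋃ d : K.Dart, Set.range (f.arc d)

/-- The image of an edge without its two end-vertices. -/
def openArc (f : Embedding K S) (d : K.Dart) : Set S :=
  Set.range (f.arc d) \ {f.point d.fst, f.point d.snd}

/-- The image of the star at `x`: the vertex `x` with all edges incident with it. -/
def star (f : Embedding K S) (x : W) : Set S :=
  {f.point x} ∪ ⋃ (d : K.Dart) (_ : d.fst = x), Set.range (f.arc d)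

/-- Two distinct edges `d`, `d'` starting at the same vertex `x` are consecutive in the cyclic order
in which the edges at `x` leave `x`. That is, they bound a common corner at `x`: arbitrarily close
to `x` one can pass from a point of `d` to a point of `d'` without meeting the star at `x` on the
way. (If `x` has degree two, its two edges are consecutive.) -/
def Consecutive (f : Embedding K S) (d d' : K.Dart) : Prop :=
  d.fst = d'.fst ∧ d ≠ d' ∧
    ∀ U ∈ 𝓝 (f.point d.fst), ∃ γ : C(I, S),
      (∀ s, γ s ∈ U) ∧
      γ 0 ∈ Set.range (f.arc d) \ {f.point d.fst} ∧
      γ 1 ∈ Set.range (f.arc d') \ {f.point d.fst} ∧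
      ∀ s, s ≠ 0 → s ≠ 1 → γ s ∉ f.star d.fst

end Embedding

/-- Discs `D_v` around the vertices and `D_e` around the edges witnessing that the embedding `g`
is generous (around vertices and around edges). -/
structure Generosity {V : Type*} {G : SimpleGraph V} {S : Type*} [TopologicalSpace S]
    (g : Embedding G S) where
  vertexDisc : V → Set S
  isOpenDisc_vertexDisc : ∀ v, IsOpenDisc (vertexDisc v)
  vertexDisc_inter_points : ∀ v, vertexDisc v ∩ Set.range g.point = {g.point v}
  vertexDisc_disjoint_arc : ∀ (v : V) (d : G.Dart), d.fst ≠ v → d.snd ≠ v →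
    Disjoint (vertexDisc v) (Set.range (g.arc d))
  edgeDisc : G.edgeSet → Set S
  isOpenDisc_edgeDisc : ∀ e, IsOpenDisc (edgeDisc e)
  edgeDisc_inter_image : ∀ d : G.Dart,
    edgeDisc ⟨d.edge, d.edge_mem⟩ ∩ g.image = g.openArc d

/-- The graph obtained from `G` by attaching, for each edge `e = uv`, two triangles `u t₁ v` and
`u t₂ v`, where the two tips `t₁ = (e, 0)` and `t₂ = (e, 1)` are new vertices. -/
def triangleGraph {V : Type*} (G : SimpleGraph V) : SimpleGraph (V ⊕ G.edgeSet × Fin 2) where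
  Adj
    | .inl u, .inl v => G.Adj u v
    | .inl v, .inr t => v ∈ (t.1 : Sym2 V)
    | .inr t, .inl v => v ∈ (t.1 : Sym2 V)
    | .inr _, .inr _ => False
  symm := ⟨by
    rintro (u | t) (v | s) h
    · exact G.adj_symm h
    · exact h
    · exact h
    · exact h⟩
  loopless := ⟨by
    rintro (u | t) h
    · exact G.irrefl h
    · exact h⟩

/-- An edge of `G`, as an (oriented) edge of the triangle graph. -/
def baseDart {V : Type*} {G : SimpleGraph V} (d : G.Dart) : (triangleGraph G).Dart :=
  ⟨(.inl d.fst, .inl d.snd), d.adj⟩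

/-- The edge from the end-vertex `v` of the edge `t.1` to the tip `t`. -/
def tipDart {V : Type*} {G : SimpleGraph V} (v : V) (t : G.edgeSet × Fin 2)
    (h : v ∈ (t.1 : Sym2 V)) : (triangleGraph G).Dart :=
  ⟨(.inl v, .inr t), h⟩

/-- The first step of the fattening construction for a generous embedding `g`, with discs `D`:
each edge `e = uv` is surrounded by a square `Q_e = u t₁ v t₂` embedded into the disc `D_e`
(apart from `u` and `v`, which lie on its boundary), so that `e` lies in the interior of `Q_e`. -/
structure SquareDrawing {V : Type*} {G : SimpleGraph V} {S : Type*} [TopologicalSpace S]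
    {g : Embedding G S} (D : Generosity g) where
  /-- the embedding of `G` together with all squares -/
  emb : Embedding (triangleGraph G) S
  emb_point : ∀ v, emb.point (.inl v) = g.point v
  emb_arc : ∀ (d : G.Dart) (t : I), emb.arc (baseDart d) t = g.arc d t
  /-- the sides of `Q_e` lie in `D_e` -/
  side_subset : ∀ (v : V) (t : G.edgeSet × Fin 2) (h : v ∈ (t.1 : Sym2 V)),
    Set.range (emb.arc (tipDart v t h)) \ {g.point v} ⊆ D.edgeDisc t.1
  /-- the interior of `Q_e` -/
  inner : G.edgeSet → Set S
  isOpenDisc_inner : ∀ e, IsOpenDisc (inner e)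
  inner_subset : ∀ e, inner e ⊆ D.edgeDisc e
  /-- the interior of `Q_e` is bounded by `Q_e` -/
  frontier_inner : ∀ e, frontier (inner e) =
    ⋃ (v : V) (i : Fin 2) (h : v ∈ (e : Sym2 V)), Set.range (emb.arc (tipDart v (e, i) h))
  openArc_subset_inner : ∀ d : G.Dart, g.openArc d ⊆ inner ⟨d.edge, d.edge_mem⟩

/-- The fattening `F(G)`: to the graph `G` with its triangles we add an edge between any two tips
`t`, `s` for which the edges `vt`, `vs` are consecutive around some vertex `v` of `G`. -/
def fattening {V : Type*} {G : SimpleGraph V} {S : Type*} [TopologicalSpace S]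
    {g : Embedding G S} {D : Generosity g} (Q : SquareDrawing D) :
    SimpleGraph (V ⊕ G.edgeSet × Fin 2) :=
  triangleGraph G ⊔ SimpleGraph.fromRel fun x y =>
    ∃ (v : V) (t s : G.edgeSet × Fin 2) (ht : v ∈ (t.1 : Sym2 V)) (hs : v ∈ (s.1 : Sym2 V)),
      x = .inr t ∧ y = .inr s ∧ Q.emb.Consecutive (tipDart v t ht) (tipDart v s hs)

end SurfaceGraph

/-!
Around a vertex `v` of `G`, the fattening contains a wheel: the hub `v` is joined to all its
neighbours, and these lie on a cycle, on which the tips follow in their cyclic order around `v` and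
the other end of each edge `vu` is put between the two tips of `vu`, to both of which it is adjacent.
Wheels are 3-connected, so the deletion of at most two vertices leaves each of these wheels
connected. The wheels at adjacent vertices `u` and `v` share four vertices, namely `u`, `v` and the
tips of `uv`. At least two of those survive, and as `G` is connected, so is what remains of the
fattening.

The definition of consecutive edges does not provide a cyclic order, and none is constructed.
The argument only uses that the neighbours of `v` stay connected with each other when `v` and one of
the neighbours are removed (`mem_of_mem_neighborSet`), which follows from two topological facts.

* `Embedding.exists_consecutive_of_mem_of_notMem`: when an edge `a` at `v` is removed, the other
  edges at `v` are still connected by the relation of being consecutive. The reason is that the arc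
  `a` does not separate small neighbourhoods of its start (`exists_nhds_joinedIn_diff_arc`), so that
  any two other edges are joined by paths close to `v` that avoid `a`; a part of such a path between
  the last visit to one class of edges and the next visit to another class exhibits two
  consecutive edges.
* `eq_tipDart_of_consecutive_baseDart`: an edge of `G` is consecutive only with the sides of its own
  square, because the disc inside this square meets no other edge of `G` and no other square.
  Hence any two consecutive edges at `v` lead to adjacent vertices of the fattening
  (`fattening_adj_of_consecutive`).

That arcs do not separate locally is proved in the plane by Eilenberg's criterion
(`joinedIn_compl_of_exp`): a closed set `X` with bounded complement does not separate `p` from `r`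
if `(z - p) / (z - r)` has a continuous logarithm on `X`. It is applied to the union of an initial
part of the arc with a set that is far from `p` and `r` and contains the rest of the arc
(`exists_ball_joinedIn_compl`).
-/

namespace SurfaceGraph

open Set Metric

/-! ### Continuous logarithms and separation in the plane -/

/-- The function `z - p` has no continuous logarithm on a circle around `p`. -/
theorem not_exists_log_sub_of_norm_ge (F : C(ℂ, ℂ)) (p : ℂ) (R : ℝ) (hR : 0 < R)
    (hF : ∀ z : ℂ, ‖z - p‖ = R → Complex.exp (F z) = z - p) : False := by
  -- Along the circle, `F z` and `iθ + F (c 0)` are lifts of the same path through the covering `exp`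
  -- with the same starting point, so they agree; but the latter is not `2π`-periodic in `θ`.
  let c : ℝ → ℂ := fun θ ↦ p + R * Complex.exp (θ * Complex.I)
  have hc : Continuous c := by fun_prop
  have hFc : ∀ θ, Complex.exp (F (c θ)) = R * Complex.exp (θ * Complex.I) := by
    intro θ
    rw [hF]
    · simp [c]
    · simp [c, Complex.norm_exp_ofReal_mul_I, abs_of_pos hR]
  have hlift : (fun θ ↦ F (c θ)) = fun θ : ℝ ↦ F (c 0) + θ * Complex.I := by
    refine Complex.isCoveringMap_exp.eq_of_comp_eq (by fun_prop) (by fun_prop) ?_ 0 (by simp)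
    funext θ
    refine Subtype.ext ?_
    simp [Complex.exp_add, hFc]
  have h := congr_fun hlift (2 * Real.pi)
  have hper : c (2 * Real.pi) = c 0 := by simp [c, Complex.exp_two_pi_mul_I]
  simp [hper] at h

/-- Eilenberg's criterion: if `(z - p) / (z - r)` has a continuous logarithm on a closed set `X` with
bounded complement, then `X` does not separate `p` from `r`. Otherwise, replacing `z - p` by
`(z - r) * exp (L z)` on the component `W` of `p` gives a continuous function without zeros on the
whole plane, which has a logarithm, although it is `z - p` on all large circles. -/
theorem joinedIn_compl_of_exp {X : Set ℂ} (hX : IsClosed X) {c : ℂ} {ε : ℝ}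
    (hb : Xᶜ ⊆ ball c ε) {p r : ℂ} (hp : p ∉ X) (hr : r ∉ X) (L : C(ℂ, ℂ))
    (hL : ∀ z ∈ X, (z - r) * Complex.exp (L z) = z - p) : JoinedIn Xᶜ p r := by
  classical
  by_contra hpr
  set W := pathComponentIn Xᶜ p with hW
  have hWo : IsOpen W := hX.isOpen_compl.pathComponentIn p
  have hpW : p ∈ W := mem_pathComponentIn_self hp
  have hcl : closure W ∩ Xᶜ ⊆ W := by
    rintro z ⟨hz, hzX⟩
    obtain ⟨y, hy, hyW⟩ := mem_closure_iff.1 hz _ (hX.isOpen_compl.pathComponentIn z)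
      (mem_pathComponentIn_self hzX)
    exact JoinedIn.trans hyW (JoinedIn.symm hy)
  have hfr : frontier W ⊆ X := by
    intro z hz
    rw [hWo.frontier_eq] at hz
    by_contra hzX
    exact hz.2 (hcl ⟨hz.1, hzX⟩)
  let Φ : ℂ → ℂ := fun z ↦ if z ∈ W then (z - r) * Complex.exp (L z) else z - p
  have hΦ : Continuous Φ :=
    Continuous.if (fun z hz ↦ hL z (hfr hz)) (by fun_prop) (by fun_prop)
  have hΦ0 : ∀ z, Φ z ≠ 0 := by
    intro z
    by_cases hz : z ∈ W
    · simp only [Φ, if_pos hz]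
      refine mul_ne_zero (sub_ne_zero.2 ?_) (Complex.exp_ne_zero _)
      rintro rfl
      exact hpr hz
    · simp only [Φ, if_neg hz]
      refine sub_ne_zero.2 ?_
      rintro rfl
      exact hz hpW
  obtain ⟨F, ⟨-, hF⟩, -⟩ := Complex.isCoveringMapOn_exp.existsUnique_continuousMap_lifts
    ⟨Φ, hΦ⟩ (Complex.exp_log (hΦ0 0)) hΦ0
  have hpc : ‖p - c‖ < ε := by simpa [dist_eq_norm] using hb hp
  have hε : 0 < ε := (norm_nonneg _).trans_lt hpc
  refine not_exists_log_sub_of_norm_ge F p (2 * ε) (by positivity) fun z hz ↦ ?_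
  rw [← Function.comp_apply (f := Complex.exp), hF]
  have hzW : z ∉ W := fun h ↦ by
    have h1 : ‖z - c‖ < ε := by
      simpa [dist_eq_norm] using hb (pathComponentIn_subset h)
    have h2 := norm_sub_le (z - c) (p - c)
    rw [sub_sub_sub_cancel_right] at h2
    linarith
  simp [Φ, hzW]

/-- Let `β` be an arc and `C` a closed set with bounded complement that meets `β` at most in its end
`β 1`. Near a point `c ∉ C`, which will be the start of `β`, the union of `β` and `C` separates no
points from each other: logarithms of `(z - p) / (z - r)` exist on `β`, which is simply connected,
and on `C`, which is far from `p` and `r`, and they can be matched at `β 1`. -/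
theorem exists_ball_joinedIn_compl (β : C(I, ℂ)) (hβ : Function.Injective β) {C : Set ℂ}
    (hC : IsClosed C) {c : ℂ} (hc : c ∉ C) {ε : ℝ} (hb : Cᶜ ⊆ ball c ε)
    (hβC : ∀ t, β t ∈ C → t = 1) :
    ∃ δ > 0, ∀ p ∈ ball c δ, ∀ r ∈ ball c δ, p ∉ range β → r ∉ range β →
      JoinedIn (range β ∪ C)ᶜ p r := by
  classical
  obtain ⟨ρ, hρ, hρC⟩ := Metric.isOpen_iff.1 hC.isOpen_compl c hc
  refine ⟨ρ / 4, by positivity, fun p hp r hr hpβ hrβ ↦ ?_⟩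
  have hpC : p ∉ C := hρC (ball_subset_ball (by linarith) hp)
  have hrC : r ∉ C := hρC (ball_subset_ball (by linarith) hr)
  rw [mem_ball_iff_norm] at hp hr
  let q : ℂ → ℂ := fun z ↦ (z - p) / (z - r)
  have hclosed : Topology.IsClosedEmbedding β := β.continuous.isClosedEmbedding hβ
  have hq0 : ∀ t, q (β t) ≠ 0 := fun t ↦ div_ne_zero
    (sub_ne_zero.2 fun h ↦ hpβ ⟨t, h⟩) (sub_ne_zero.2 fun h ↦ hrβ ⟨t, h⟩)
  have hqβ : Continuous fun t ↦ q (β t) := by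
    refine Continuous.div (by fun_prop) (by fun_prop) fun t ↦ ?_
    exact sub_ne_zero.2 fun h ↦ hrβ ⟨t, h⟩
  -- Far from `p` and `r` the quotient `q` is close to `1`, so the principal logarithm is defined.
  have hslit : ∀ z ∈ C, q z ∈ Complex.slitPlane := by
    intro z hz
    have hz' : ρ ≤ ‖z - c‖ := by
      by_contra! h
      exact hρC (mem_ball_iff_norm.2 h) hz
    have h1 : ‖z - c‖ ≤ ‖z - r‖ + ‖r - c‖ := by
      simpa using norm_add_le (z - r) (r - c)
    have h2 : ‖r - p‖ ≤ ‖r - c‖ + ‖p - c‖ := by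
      simpa using norm_sub_le (r - c) (p - c)
    have h3 : 0 < ‖z - r‖ := by linarith
    have h4 : q z = 1 + (r - p) / (z - r) := by
      have : z - r ≠ 0 := norm_pos_iff.1 h3
      simp only [q]
      field_simp
      ring
    rw [h4]
    refine Complex.mem_slitPlane_of_norm_lt_one ?_
    rw [norm_div, div_lt_one h3]
    linarith
  have hqC : ContinuousOn (fun z ↦ Complex.log (q z)) C := by
    refine ContinuousOn.clog (ContinuousOn.div (by fun_prop) (by fun_prop) fun z hz ↦ ?_) hslit
    exact sub_ne_zero.2 fun h ↦ hrC (h ▸ hz)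
  obtain ⟨l, hl1, hl⟩ : ∃ l : C(I, ℂ), l 1 = Complex.log (q (β 1)) ∧
      ∀ t, Complex.exp (l t) = q (β t) := by
    obtain ⟨l, ⟨hl1, hl⟩, -⟩ := Complex.isCoveringMapOn_exp.existsUnique_continuousMap_lifts
      (⟨fun x : ℝ ↦ q (β (projIcc 0 1 zero_le_one x)), hqβ.comp continuous_projIcc⟩ : C(ℝ, ℂ))
      (a₀ := 1) (e₀ := Complex.log (q (β 1))) (by simp [Complex.exp_log (hq0 1)])
      (fun x ↦ hq0 _)
    exact ⟨⟨fun t ↦ l t, by fun_prop⟩, by simpa using hl1, fun t ↦ by simpa using congr_fun hl t⟩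
  obtain ⟨M, hM⟩ := l.exists_extension' hclosed
  -- The two logarithms agree where the pieces meet, namely at most in the end `β 1`.
  let f : ℂ → ℂ := fun z ↦ if z ∈ C then Complex.log (q z) else M z
  have hfC : EqOn f (fun z ↦ Complex.log (q z)) C := fun z hz ↦ if_pos hz
  have hfβ : EqOn f M (range β) := by
    rintro _ ⟨t, rfl⟩
    by_cases ht : β t ∈ C
    · obtain rfl := hβC t ht
      rw [hfC ht, ← Function.comp_apply (f := M), hM, hl1]
    · exact if_neg ht
  have hf : ContinuousOn f (range β ∪ C) :=
    (M.continuous.continuousOn.congr hfβ).union_of_isClosed (hqC.congr hfC)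
      hclosed.isClosed_range hC
  have hX : IsClosed (range β ∪ C) := hclosed.isClosed_range.union hC
  obtain ⟨N, hN⟩ := ContinuousMap.exists_restrict_eq hX ⟨_, hf.domRestrict⟩
  have hN' : ∀ z ∈ range β ∪ C, N z = f z := fun z hz ↦ congr($hN ⟨z, hz⟩)
  refine joinedIn_compl_of_exp (c := c) (ε := ε) hX
    (subset_trans (compl_subset_compl.2 subset_union_right) hb) (by simp_all) (by simp_all)
    N fun z hz ↦ ?_
  have hzr : z - r ≠ 0 := by
    rintro h
    obtain rfl := sub_eq_zero.1 h
    exact hz.elim hrβ hrC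
  have : Complex.exp (N z) = q z := by
    rw [hN' z hz]
    by_cases hzC : z ∈ C
    · rw [hfC hzC]
      exact Complex.exp_log (Complex.slitPlane_ne_zero (hslit z hzC))
    · obtain ⟨t, rfl⟩ := hz.resolve_right hzC
      rw [hfβ ⟨t, rfl⟩, ← Function.comp_apply (f := M), hM]
      exact hl t
  rw [this]
  simp only [q]
  field_simp

/-! ### Arcs and paths in a surface -/

theorem exists_forall_le_of_eventually_nhds_zero {p : I → Prop} (h : ∀ᶠ t in 𝓝 (0 : I), p t) :
    ∃ s : I, 0 < s ∧ s < 1 ∧ ∀ t ≤ s, p t := by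
  obtain ⟨η, hη, hp⟩ := Metric.eventually_nhds_iff.1 h
  refine ⟨⟨min (η / 2) (1 / 2), by positivity, (min_le_right _ _).trans (by norm_num)⟩, ?_, ?_, ?_⟩
  · exact Subtype.mk_lt_mk.2 (by positivity)
  · exact Subtype.mk_lt_mk.2 ((min_le_right _ _).trans_lt (by norm_num))
  · intro t ht
    have h1 : (t : ℝ) ≤ min (η / 2) (1 / 2) := ht
    have h2 := min_le_left (η / 2) (1 / 2 : ℝ)
    refine hp ?_
    rw [Subtype.dist_eq, Real.dist_eq, Icc.coe_zero, sub_zero, abs_of_nonneg t.2.1]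
    linarith

/-- An arc `a` in a surface does not separate a neighbourhood of its start locally: points near
the start and off the arc can be joined near the start and off the arc. Here the whole arc is to be
avoided, although it may leave the neighbourhood and return to it. -/
theorem exists_nhds_joinedIn_diff_arc {S : Type*} [TopologicalSpace S] [T2Space S] {D : Set S}
    (hD : IsOpenDisc D) {x : S} (hx : x ∈ D) (a : C(I, S)) (ha : Function.Injective a)
    (ha0 : a 0 = x) {U : Set S} (hU : U ∈ 𝓝 x) :
    ∃ N ∈ 𝓝 x, ∀ y ∈ N, ∀ z ∈ N, y ∉ range a → z ∉ range a → JoinedIn (U \ range a) y z := by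
  obtain ⟨φ, hφ, rfl⟩ := hD
  obtain ⟨c, rfl⟩ := hx
  obtain ⟨ε, hε, hεU⟩ := Metric.mem_nhds_iff.1 (hφ.continuous.continuousAt hU)
  have hev : ∀ᶠ t in 𝓝 (0 : I), a t ∈ φ '' ball c ε := by
    refine a.continuous.continuousAt.eventually_mem ?_
    rw [ha0]
    exact hφ.isOpenMap.image_mem_nhds (ball_mem_nhds c hε)
  obtain ⟨s, hs0, -, hs⟩ := exists_forall_le_of_eventually_nhds_zero hev
  -- `β` is the initial part of the arc `a` in the disc; the rest of `a` is put into `C`.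
  choose β hβball hβ using fun t : I ↦ hs (s * t) (mul_le_of_le_one_right' t.2.2)
  have hβc : Continuous β := by
    rw [hφ.isEmbedding.continuous_iff]
    simp only [Function.comp_def, hβ]
    fun_prop
  have hβi : Function.Injective β := fun t t' h ↦ by
    have h1 := ha ((hβ t).symm.trans ((congrArg φ h).trans (hβ t')))
    have h2 : (s : ℝ) * t = s * t' := congrArg Subtype.val h1
    exact Subtype.ext (mul_left_cancel₀ (ne_of_gt hs0) h2)
  let C : Set ℂ := φ ⁻¹' (a '' Ici s) ∪ (ball c ε)ᶜ
  have hC : IsClosed C :=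
    ((isClosed_Ici.isCompact.image a.continuous).isClosed.preimage hφ.continuous).union
      isOpen_ball.isClosed_compl
  have hcC : c ∉ C := by
    rintro (⟨t, ht, h⟩ | h)
    · rw [← ha0] at h
      obtain rfl := ha h
      exact (lt_of_lt_of_le hs0 ht).false
    · exact h (mem_ball_self hε)
  obtain ⟨δ, hδ, h⟩ := exists_ball_joinedIn_compl ⟨β, hβc⟩ hβi hC hcC (ε := ε)
    (fun z hz ↦ by simp_all [C]) (by
      rintro t (⟨t', ht', h⟩ | h)
      · obtain rfl := ha (h.trans (hβ t))
        have h1 : (s : ℝ) ≤ s * t := ht'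
        have h2 : (0 : ℝ) < s := hs0
        exact le_antisymm t.2.2 (show (1 : ℝ) ≤ t from (le_mul_iff_one_le_right h2).1 h1)
      · exact absurd (hβball t) h)
  refine ⟨φ '' ball c δ, hφ.isOpenMap.image_mem_nhds (ball_mem_nhds c hδ), ?_⟩
  have hβa : ∀ z, φ z ∉ range a → z ∉ range β := by
    rintro _ hz ⟨t, rfl⟩
    exact hz ⟨_, (hβ t).symm⟩
  rintro _ ⟨p, hp, rfl⟩ _ ⟨r, hr, rfl⟩ hpa hra
  refine ((h p hp r hr (hβa p hpa) (hβa r hra)).map hφ.continuous).mono ?_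
  rintro _ ⟨z, hz, rfl⟩
  rw [mem_compl_iff, mem_union, not_or] at hz
  refine ⟨hεU (by simp_all [C]), ?_⟩
  rintro ⟨t, ht⟩
  by_cases hst : s ≤ t
  · exact hz.2 (Or.inl ⟨t, hst, ht⟩)
  · refine hz.1 ⟨⟨t / s, div_nonneg t.2.1 s.2.1, div_le_one_of_le₀ (le_of_not_ge hst) s.2.1⟩, ?_⟩
    refine hφ.injective ?_
    rw [ContinuousMap.coe_mk, hβ, ← ht]
    congr 1
    exact Subtype.ext (mul_div_cancel₀ _ (ne_of_gt hs0))

/-- A path from a closed set `A` to a closed set `B` that avoids `A ∩ B` contains a path from `A`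
to `B` whose interior avoids `A ∪ B`. -/
theorem exists_subpath_between {S : Type*} [TopologicalSpace S] {A B T : Set S} (hA : IsClosed A)
    (hB : IsClosed B) (hAB : Disjoint (A ∩ B) T) {y z : S} (hyz : JoinedIn T y z) (hy : y ∈ A)
    (hz : z ∈ B) :
    ∃ γ : C(I, S), (∀ s, γ s ∈ T) ∧ γ 0 ∈ A ∧ γ 1 ∈ B ∧
      ∀ s, s ≠ 0 → s ≠ 1 → γ s ∉ A ∪ B := by
  obtain ⟨p, hp⟩ := hyz
  -- Cut the path at its first visit `v` to `B` and at its last visit `u` to `A` before that.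
  obtain ⟨v, hvB, hv⟩ := (hB.preimage p.continuous).isCompact.exists_isLeast ⟨1, by simpa⟩
  obtain ⟨u, ⟨huA, huv⟩, hu⟩ := ((hA.preimage p.continuous).inter
    (isClosed_Iic (a := v))).isCompact.exists_isGreatest ⟨0, by simpa, v.2.1⟩
  have huv' : u < v := lt_of_le_of_ne huv fun h ↦
    disjoint_left.1 hAB ⟨huA, by rw [h]; exact hvB⟩ (hp u)
  have h0 : (0 : ℝ) < v - u := sub_pos.2 huv'
  have hle : ∀ s : I, (u : ℝ) + (v - u) * s ≤ v := fun s ↦ by nlinarith [s.2.2]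
  have hmem : ∀ s : I, (u : ℝ) + (v - u) * s ∈ I := fun s ↦
    ⟨add_nonneg u.2.1 (mul_nonneg h0.le s.2.1), (hle s).trans v.2.2⟩
  refine ⟨⟨fun s ↦ p ⟨u + (v - u) * s, hmem s⟩, by fun_prop⟩, fun s ↦ hp _, ?_, ?_, ?_⟩
  · simpa using huA
  · simpa using hvB
  · intro s hs0 hs1
    have hs0' : (0 : ℝ) < s := unitInterval.pos_iff_ne_zero.2 hs0
    have hs1' : (s : ℝ) < 1 := unitInterval.lt_one_iff_ne_one.2 hs1
    rintro (h | h)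
    · have : (u : ℝ) + (v - u) * s ≤ u := hu ⟨h, hle s⟩
      nlinarith
    · have : (v : ℝ) ≤ u + (v - u) * s := hv h
      nlinarith

/-! ### Edges around a vertex of an embedded graph -/

namespace Embedding

variable {W : Type*} {K : SimpleGraph W} {S : Type*} [TopologicalSpace S] (f : Embedding K S)

theorem arc_zero (d : K.Dart) : f.arc d 0 = f.point d.fst := (f.arc d).source

theorem arc_one (d : K.Dart) : f.arc d 1 = f.point d.snd := (f.arc d).target

theorem Consecutive.symm {f : Embedding K S} {d d' : K.Dart} (h : f.Consecutive d d') :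
    f.Consecutive d' d := by
  obtain ⟨h1, h2, h3⟩ := h
  refine ⟨h1.symm, h2.symm, fun U hU ↦ ?_⟩
  obtain ⟨γ, hγU, hγ0, hγ1, hγ⟩ := h3 U (h1 ▸ hU)
  have hx : f.point d.fst = f.point d'.fst := congrArg _ h1
  refine ⟨⟨fun s ↦ γ (σ s), by fun_prop⟩, fun s ↦ hγU _, ?_, ?_,
    fun s hs0 hs1 ↦ h1 ▸ hγ _ ?_ ?_⟩
  · exact ⟨by simpa using hγ1.1, fun h ↦ hγ1.2 (by simpa [hx] using h)⟩
  · exact ⟨by simpa using hγ0.1, fun h ↦ hγ0.2 (by simpa [hx] using h)⟩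
  · rwa [Ne, unitInterval.symm_eq_zero]
  · rwa [Ne, unitInterval.symm_eq_one]

theorem edge_ne_of_fst_eq {d d' : K.Dart} (h : d.fst = d'.fst) (hne : d ≠ d') :
    d.edge ≠ d'.edge := by
  rw [Ne, SimpleGraph.dart_edge_eq_iff, not_or]
  refine ⟨hne, ?_⟩
  rintro rfl
  exact d'.adj.ne h.symm

/-- An interior point of an edge lies on no other edge. -/
theorem arc_notMem_range {d d' : K.Dart} (h : d.edge ≠ d'.edge) {t : I} (h0 : t ≠ 0)
    (h1 : t ≠ 1) : f.arc d t ∉ range (f.arc d') := by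
  rintro ⟨t', ht'⟩
  exact (f.eq_endpoint_of_arc_eq_arc d d' t t' h ht'.symm).elim h0 h1

theorem point_mem_range_iff (d : K.Dart) (w : W) :
    f.point w ∈ range (f.arc d) ↔ w = d.fst ∨ w = d.snd := by
  constructor
  · rintro ⟨t, ht⟩
    obtain rfl | rfl := f.eq_endpoint_of_arc_eq_point d t w ht
    · exact Or.inl (f.point_injective (ht.symm.trans (f.arc_zero d)))
    · exact Or.inr (f.point_injective (ht.symm.trans (f.arc_one d)))
  · rintro (rfl | rfl)
    exacts [⟨0, f.arc_zero d⟩, ⟨1, f.arc_one d⟩]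

/-- Two different edges meet at most in common end-vertices. -/
theorem eq_point_of_mem_range_of_mem_range {d d' : K.Dart} (h : d.edge ≠ d'.edge) {x : S}
    (hx : x ∈ range (f.arc d)) (hx' : x ∈ range (f.arc d')) :
    ∃ w, x = f.point w ∧ (w = d.fst ∨ w = d.snd) ∧ (w = d'.fst ∨ w = d'.snd) := by
  obtain ⟨t, rfl⟩ := hx
  suffices ∃ w, f.arc d t = f.point w by
    obtain ⟨w, hw⟩ := this
    refine ⟨w, hw, ?_, ?_⟩
    · exact (f.point_mem_range_iff d w).1 (hw ▸ ⟨t, rfl⟩)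
    · exact (f.point_mem_range_iff d' w).1 (hw ▸ hx')
  obtain ⟨t', ht'⟩ := hx'
  obtain rfl | rfl := f.eq_endpoint_of_arc_eq_arc d d' t t' h ht'.symm
  exacts [⟨_, f.arc_zero d⟩, ⟨_, f.arc_one d⟩]

theorem exists_arc_mem_nhds (d : K.Dart) {N : Set S} (hN : N ∈ 𝓝 (f.point d.fst)) :
    ∃ t : I, t ≠ 0 ∧ t ≠ 1 ∧ f.arc d t ∈ N := by
  rw [← f.arc_zero] at hN
  obtain ⟨s, h0, h1, h⟩ := exists_forall_le_of_eventually_nhds_zero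
    ((f.arc d).continuous.continuousAt.eventually_mem hN)
  exact ⟨s, h0.ne', h1.ne, h s le_rfl⟩

/-- Around a vertex of finite degree, the relation of being consecutive connects the incident edges,
even after the removal of one edge `a`: otherwise one could split the remaining edges into two
classes, and a path from one class to the other that is close to the vertex and avoids `a` contains
a path showing that two edges from different classes are consecutive. -/
theorem exists_consecutive_of_mem_of_notMem [T2Space S] {x : W} {D : Set S} (hD : IsOpenDisc D)
    (hx : f.point x ∈ D) (hfin : {d : K.Dart | d.fst = x}.Finite) {a : K.Dart} (ha : a.fst = x)
    {P : Set K.Dart} (haP : a ∉ P) {d₀ d₁ : K.Dart} (hd₀ : d₀.fst = x) (hd₀P : d₀ ∈ P)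
    (hd₁ : d₁.fst = x) (hd₁P : d₁ ∉ P) (hd₁a : d₁ ≠ a) :
    ∃ d d' : K.Dart, d.fst = x ∧ d ∈ P ∧ d' ∉ P ∧ d' ≠ a ∧ f.Consecutive d d' := by
  by_contra! hcon
  let P₀ : Set K.Dart := {d | d.fst = x ∧ d ∈ P}
  let P₁ : Set K.Dart := {d | d.fst = x ∧ d ∉ P ∧ d ≠ a}
  have hP₀ : P₀.Finite := hfin.subset fun d h ↦ h.1
  have hP₁ : P₁.Finite := hfin.subset fun d h ↦ h.1
  have hU : ∀ d ∈ P₀, ∀ d' ∈ P₁, ∃ U ∈ 𝓝 (f.point x), ∀ γ : C(I, S), (∀ s, γ s ∈ U) →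
      γ 0 ∈ range (f.arc d) \ {f.point x} → γ 1 ∈ range (f.arc d') \ {f.point x} →
      ∃ s, s ≠ 0 ∧ s ≠ 1 ∧ γ s ∈ f.star x := by
    rintro d ⟨rfl, hdP⟩ d' ⟨hd', hd'P, hd'a⟩
    have h := hcon d d' rfl hdP hd'P hd'a
    simp only [Consecutive, not_and] at h
    have h := h hd'.symm (fun h ↦ hd'P (h ▸ hdP))
    push Not at h
    exact h
  choose! U hUx hUγ using hU
  let V : Set S := ⋂ d ∈ P₀, ⋂ d' ∈ P₁, U d d'
  have hV : V ∈ 𝓝 (f.point x) := (Filter.biInter_mem hP₀).2 fun d hd ↦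
    (Filter.biInter_mem hP₁).2 fun d' hd' ↦ hUx d hd d' hd'
  have hclosed : ∀ d, IsClosed (range (f.arc d)) := fun d ↦
    (isCompact_range (f.arc d).continuous).isClosed
  obtain ⟨N, hN, hNa⟩ := exists_nhds_joinedIn_diff_arc hD hx (f.arc a).toContinuousMap
    (f.arc_injective a) (by simp [ha]) hV
  obtain ⟨t₀, ht₀, ht₀', ht₀N⟩ := f.exists_arc_mem_nhds d₀ (hd₀.symm ▸ hN)
  obtain ⟨t₁, ht₁, ht₁', ht₁N⟩ := f.exists_arc_mem_nhds d₁ (hd₁.symm ▸ hN)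
  have hjoin := hNa _ ht₀N _ ht₁N
    (f.arc_notMem_range (edge_ne_of_fst_eq (hd₀.trans ha.symm) fun h ↦ haP (h ▸ hd₀P)) ht₀ ht₀')
    (f.arc_notMem_range (edge_ne_of_fst_eq (hd₁.trans ha.symm) hd₁a) ht₁ ht₁')
  have hxa : f.point x ∈ range (f.arc a) := (f.point_mem_range_iff a x).2 (Or.inl ha.symm)
  obtain ⟨γ, hγ, hγ0, hγ1, hγs⟩ := exists_subpath_between
    (A := ⋃ d ∈ P₀, range (f.arc d)) (B := ⋃ d ∈ P₁, range (f.arc d))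
    (hP₀.isClosed_biUnion fun d _ ↦ hclosed d) (hP₁.isClosed_biUnion fun d _ ↦ hclosed d)
    (by
      rw [disjoint_left]
      rintro y ⟨hy0, hy1⟩ ⟨-, hya⟩
      simp only [mem_iUnion] at hy0 hy1
      obtain ⟨d, ⟨hd, hdP⟩, hyd⟩ := hy0
      obtain ⟨d', ⟨hd', hd'P, -⟩, hyd'⟩ := hy1
      obtain ⟨w, rfl, hw, hw'⟩ := f.eq_point_of_mem_range_of_mem_range
        (edge_ne_of_fst_eq (hd.trans hd'.symm) fun h ↦ hd'P (h ▸ hdP)) hyd hyd'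
      -- Two edges at `x` have no other common end-vertex.
      obtain rfl | rfl := hw
      · exact hya (hd.symm ▸ hxa)
      obtain h | h := hw'
      · exact hya (by rw [h, hd']; exact hxa)
      · refine hd'P ?_
        have : d = d' := SimpleGraph.Dart.ext _ _ (Prod.ext (hd.trans hd'.symm) h)
        exact this ▸ hdP)
    hjoin (mem_biUnion (show d₀ ∈ P₀ from ⟨hd₀, hd₀P⟩) ⟨t₀, rfl⟩)
    (mem_biUnion (show d₁ ∈ P₁ from ⟨hd₁, hd₁P, hd₁a⟩) ⟨t₁, rfl⟩)
  have hγx : ∀ s, γ s ≠ f.point x := fun s h ↦ (hγ s).2 (by rw [h]; exact hxa)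
  simp only [mem_iUnion] at hγ0 hγ1
  obtain ⟨d, hd, hγd⟩ := hγ0
  obtain ⟨d', hd', hγd'⟩ := hγ1
  obtain ⟨s, hs0, hs1, hs⟩ := hUγ d hd d' hd' γ
    (fun s ↦ mem_iInter₂.1 (mem_iInter₂.1 (hγ s).1 d hd) d' hd') ⟨hγd, hγx 0⟩ ⟨hγd', hγx 1⟩
  refine hγs s hs0 hs1 ?_
  obtain h | h := hs
  · exact absurd h (hγx s)
  · simp only [mem_iUnion] at h
    obtain ⟨b, hb, hsb⟩ := h
    by_cases hbP : b ∈ P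
    · exact Or.inl (mem_biUnion (show b ∈ P₀ from ⟨hb, hbP⟩) hsb)
    · refine Or.inr (mem_biUnion (show b ∈ P₁ from ⟨hb, hbP, ?_⟩) hsb)
      rintro rfl
      exact (hγ s).2 hsb

end Embedding

/-! ### The discs inside the squares -/

/-- A preconnected set that meets `U` but not its frontier lies in `U`. -/
theorem subset_of_isPreconnected_of_disjoint_frontier {X : Type*} [TopologicalSpace X]
    {s U : Set X} (hs : IsPreconnected s) (hU : IsOpen U) (hd : Disjoint s (frontier U))
    (hne : (s ∩ U).Nonempty) : s ⊆ U := by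
  refine hs.subset_left_of_subset_union hU isClosed_closure.isOpen_compl
    (disjoint_compl_right.mono_right (compl_subset_compl.2 subset_closure)) (fun x hx ↦ ?_) hne
  by_contra h
  rw [mem_union, not_or, notMem_compl_iff] at h
  exact disjoint_left.1 hd hx (hU.frontier_eq ▸ ⟨h.2, h.1⟩)

theorem IsOpenDisc.isOpen {X : Type*} [TopologicalSpace X] {D : Set X} (hD : IsOpenDisc D) :
    IsOpen D := by
  obtain ⟨φ, hφ, rfl⟩ := hD
  exact hφ.isOpen_range

section Squares

variable {V : Type*} {G : SimpleGraph V} {S : Type*} [TopologicalSpace S]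
  {g : Embedding G S} {D : Generosity g} (Q : SquareDrawing D)

theorem mem_frontier_inner_iff {e : G.edgeSet} {x : S} : x ∈ frontier (Q.inner e) ↔
    ∃ (v : V) (i : Fin 2) (h : v ∈ (e : Sym2 V)), x ∈ range (Q.emb.arc (tipDart v (e, i) h)) := by
  simp only [Q.frontier_inner, mem_iUnion]

theorem openArc_subset_arc_baseDart (d : G.Dart) :
    g.openArc d ⊆ range (Q.emb.arc (baseDart d)) := by
  rintro _ ⟨⟨t, rfl⟩, -⟩
  exact ⟨t, Q.emb_arc d t⟩

theorem point_inl_notMem_inner (e : G.edgeSet) (w : V) : Q.emb.point (.inl w) ∉ Q.inner e := by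
  obtain ⟨e, he⟩ := e
  obtain ⟨d, rfl⟩ : ∃ d : G.Dart, d.edge = e := by
    induction e with
    | _ u v => exact ⟨⟨(u, v), he⟩, rfl⟩
  intro h
  rw [Q.emb_point] at h
  have h1 : g.point w ∈ g.openArc d := by
    rw [← D.edgeDisc_inter_image]
    exact ⟨Q.inner_subset _ h, Or.inl ⟨w, rfl⟩⟩
  obtain rfl | rfl := (g.point_mem_range_iff d w).1 h1.1
  · exact h1.2 (Or.inl rfl)
  · exact h1.2 (Or.inr rfl)

theorem edge_tipDart_ne {v w : V} {t s : G.edgeSet × Fin 2} (hv : v ∈ (t.1 : Sym2 V))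
    (hw : w ∈ (s.1 : Sym2 V)) (hts : t ≠ s) : (tipDart v t hv).edge ≠ (tipDart w s hw).edge := by
  simp [tipDart, SimpleGraph.Dart.edge, hts]

/-- A side of a square, without its end-vertex in `G`, lies in the interior of another square as
soon as one of its points does, since the two squares are disjoint apart from vertices of `G`. -/
theorem arc_tipDart_mem_inner {e : G.edgeSet} {t : G.edgeSet × Fin 2} (hte : t.1 ≠ e) {v : V}
    (hv : v ∈ (t.1 : Sym2 V)) {s : I} (hs : s ≠ 0)
    (h : Q.emb.arc (tipDart v t hv) s ∈ Q.inner e) {s' : I} (hs' : s' ≠ 0) :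
    Q.emb.arc (tipDart v t hv) s' ∈ Q.inner e := by
  have hpre : IsPreconnected (Q.emb.arc (tipDart v t hv) '' Ioi 0) :=
    isPreconnected_Ioi.image _ (Q.emb.arc _).continuous.continuousOn
  refine subset_of_isPreconnected_of_disjoint_frontier hpre (Q.isOpenDisc_inner e).isOpen ?_
    ⟨_, ⟨s, unitInterval.pos_iff_ne_zero.2 hs, rfl⟩, h⟩
    ⟨s', unitInterval.pos_iff_ne_zero.2 hs', rfl⟩
  rw [disjoint_left]
  rintro _ ⟨r, hr, rfl⟩ hrf
  obtain ⟨w, i, hw, hrw⟩ := (mem_frontier_inner_iff Q).1 hrf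
  obtain ⟨x, hx, hx1, hx2⟩ := Q.emb.eq_point_of_mem_range_of_mem_range
    (edge_tipDart_ne hv hw fun h ↦ hte (congrArg Prod.fst h)) ⟨r, rfl⟩ hrw
  obtain rfl | rfl := hx1
  · exact hr.ne' (Q.emb.arc_injective _ (hx.trans (Q.emb.arc_zero _).symm))
  · obtain h | h := hx2
    · exact Sum.inr_ne_inl h
    · exact hte (congrArg Prod.fst (Sum.inr_injective h))

/-- No side of a square meets the interior of another square: otherwise the other side at the same
tip would also lie in that interior, apart from its end-vertex in `G`, so both end-vertices of the
edge `t.1` would lie on the square around `e`. -/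
theorem arc_tipDart_notMem_inner {e : G.edgeSet} {t : G.edgeSet × Fin 2} (hte : t.1 ≠ e) {v : V}
    (hv : v ∈ (t.1 : Sym2 V)) (s : I) : Q.emb.arc (tipDart v t hv) s ∉ Q.inner e := by
  intro h
  have hs : s ≠ 0 := by
    rintro rfl
    rw [Q.emb.arc_zero] at h
    exact point_inl_notMem_inner Q e v h
  have htip : Q.emb.point (.inr t) ∈ Q.inner e := by
    have := arc_tipDart_mem_inner Q hte hv hs h (s' := 1) one_ne_zero
    rwa [Q.emb.arc_one] at this
  have hmem : ∀ w ∈ (t.1 : Sym2 V), w ∈ (e : Sym2 V) := by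
    intro w hw
    have hcl : Q.emb.point (.inl w) ∈ closure (Q.inner e) := by
      rw [mem_closure_iff_nhds]
      intro N hN
      obtain ⟨r, hr0, -, hr⟩ := Q.emb.exists_arc_mem_nhds (tipDart w t hw) hN
      refine ⟨_, hr, arc_tipDart_mem_inner Q hte hw (s := 1) one_ne_zero ?_ hr0⟩
      rwa [Q.emb.arc_one]
    have hfr : Q.emb.point (.inl w) ∈ frontier (Q.inner e) := by
      rw [(Q.isOpenDisc_inner e).isOpen.frontier_eq]
      exact ⟨hcl, point_inl_notMem_inner Q e w⟩
    obtain ⟨z, i, hz, hwz⟩ := (mem_frontier_inner_iff Q).1 hfr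
    obtain h | h := (Q.emb.point_mem_range_iff _ _).1 hwz
    · exact Sum.inl_injective h ▸ hz
    · exact absurd h Sum.inl_ne_inr
  obtain ⟨⟨e', he'⟩, i⟩ := t
  induction e' with
  | _ a b =>
    refine hte (Subtype.ext ?_)
    exact ((Sym2.mem_and_mem_iff (G.ne_of_adj he')).1
      ⟨hmem a (Sym2.mem_mk_left a b), hmem b (Sym2.mem_mk_right a b)⟩).symm

/-- An edge of `G` is separated by the surrounding square from all other edges, so only the two
sides of that square can be consecutive with it. -/
theorem eq_tipDart_of_consecutive_baseDart [T2Space S] {d : G.Dart} {b : (triangleGraph G).Dart}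
    (h : Q.emb.Consecutive (baseDart d) b) :
    ∃ i, b = tipDart d.fst (⟨d.edge, d.edge_mem⟩, i) (Sym2.mem_mk_left _ _) := by
  set e : G.edgeSet := ⟨d.edge, d.edge_mem⟩ with he
  obtain ⟨hb, hne, h⟩ := h
  change .inl d.fst = b.fst at hb
  by_contra! hbt
  have hu : ∀ w, w ∈ (e : Sym2 V) ↔ w = d.fst ∨ w = d.snd := fun w ↦ Sym2.mem_iff
  have hsnd : d.snd ∈ (e : Sym2 V) := Sym2.mem_mk_right _ _
  -- In the neighbourhood `U` of `d.fst`, the square around `d` consists of its sides at `d.fst`.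
  let U : Set S := (⋃ i, range (Q.emb.arc (tipDart d.snd (e, i) hsnd)))ᶜ
  have hU : U ∈ 𝓝 (Q.emb.point (baseDart d).fst) := by
    refine (isClosed_iUnion_of_finite fun i ↦
      (isCompact_range (Q.emb.arc _).continuous).isClosed).isOpen_compl.mem_nhds ?_
    rw [mem_compl_iff, mem_iUnion]
    rintro ⟨i, hi⟩
    obtain h | h := (Q.emb.point_mem_range_iff _ _).1 hi
    · exact d.adj.ne (Sum.inl_injective h)
    · exact Sum.inl_ne_inr h
  obtain ⟨γ, hγU, ⟨hγ0, hγ0'⟩, ⟨hγ1, hγ1'⟩, hγ⟩ := h U hU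
  have hfr : ∀ s, γ s ∈ frontier (Q.inner e) →
      ∃ i, γ s ∈ range (Q.emb.arc (tipDart d.fst (e, i) (Sym2.mem_mk_left _ _))) := by
    intro s hs
    obtain ⟨w, i, hw, hsw⟩ := (mem_frontier_inner_iff Q).1 hs
    obtain rfl | rfl := (hu w).1 hw
    · exact ⟨i, hsw⟩
    · exact absurd (mem_iUnion.2 ⟨i, hsw⟩) (hγU s)
  have h0 : γ 0 ∈ Q.inner e := by
    refine Q.openArc_subset_inner d ⟨?_, ?_⟩
    · obtain ⟨t, ht⟩ := hγ0
      exact ⟨t, (Q.emb_arc d t).symm.trans ht⟩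
    · rintro (h | h)
      · exact hγ0' (h.trans (Q.emb_point _).symm)
      · refine hγU 0 (mem_iUnion.2 ⟨0, 0, ?_⟩)
        rw [Q.emb.arc_zero, h]
        exact Q.emb_point _
  -- An edge at `d.fst` other than the sides of the square meets the square in `d.fst` at most.
  have hbfr : γ 1 ∉ frontier (Q.inner e) := by
    intro hs
    obtain ⟨i, hi⟩ := hfr 1 hs
    obtain ⟨x, hx, hx1, hx2⟩ := Q.emb.eq_point_of_mem_range_of_mem_range
      (Embedding.edge_ne_of_fst_eq hb.symm (hbt i)) hγ1 hi
    have hxv : x ≠ .inl d.fst := by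
      rintro rfl
      exact hγ1' hx
    refine hbt i (SimpleGraph.Dart.ext _ _ (Prod.ext hb.symm ?_))
    rw [← hx1.resolve_left (hb ▸ hxv)]
    exact hx2.resolve_left hxv
  have hfr' : ∀ s, γ s ∉ frontier (Q.inner e) := by
    intro s hs
    by_cases hs0 : s = 0
    · subst hs0
      rw [(Q.isOpenDisc_inner e).isOpen.frontier_eq] at hs
      exact hs.2 h0
    by_cases hs1 : s = 1
    · subst hs1
      exact hbfr hs
    obtain ⟨i, hi⟩ := hfr s hs
    exact hγ s hs0 hs1 (Or.inr (mem_iUnion₂.2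
      ⟨tipDart d.fst (e, i) (Sym2.mem_mk_left _ _), rfl, hi⟩))
  have h1 : γ 1 ∈ Q.inner e := by
    refine subset_of_isPreconnected_of_disjoint_frontier (isPreconnected_range γ.continuous)
      (Q.isOpenDisc_inner e).isOpen ?_ ⟨_, ⟨0, rfl⟩, h0⟩ ⟨1, rfl⟩
    rw [disjoint_left]
    rintro _ ⟨s, rfl⟩
    exact hfr' s
  obtain ⟨⟨x, y⟩, hadj⟩ := b
  obtain rfl : .inl d.fst = x := hb
  obtain u | t := y
  · -- `b` is an edge of `G`, so it avoids the disc around `d`.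
    let d' : G.Dart := ⟨(d.fst, u), hadj⟩
    have h2 : γ 1 ∈ g.openArc d := by
      rw [← D.edgeDisc_inter_image]
      refine ⟨Q.inner_subset _ h1, Or.inr (mem_iUnion.2 ⟨d', ?_⟩)⟩
      obtain ⟨r, hr⟩ := hγ1
      exact ⟨r, (Q.emb_arc d' r).symm.trans hr⟩
    obtain ⟨x, hx, hx1, -⟩ := Q.emb.eq_point_of_mem_range_of_mem_range
      (Embedding.edge_ne_of_fst_eq (d := baseDart d) (d' := ⟨(.inl d.fst, .inl u), hadj⟩) rfl hne)
      (openArc_subset_arc_baseDart Q d h2) hγ1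
    obtain rfl | rfl := hx1
    · exact hγ1' hx
    · exact h2.2 (Or.inr (hx.trans (Q.emb_point _)))
  · obtain ⟨r, hr⟩ := hγ1
    have hte : t.1 ≠ e := by
      rintro hte
      refine hbt t.2 (SimpleGraph.Dart.ext _ _ (Prod.ext rfl ?_))
      exact congrArg Sum.inr (Prod.ext hte rfl)
    refine arc_tipDart_notMem_inner Q hte hadj r ?_
    exact hr ▸ h1

end Squares

/-! ### Connectivity of the fattening -/

section Fattening

variable {V : Type*} {G : SimpleGraph V} {S : Type*} [TopologicalSpace S]
  {g : Embedding G S} {D : Generosity g} (Q : SquareDrawing D)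

theorem finite_setOf_fst_eq_inl [G.LocallyFinite] (v : V) :
    {d : (triangleGraph G).Dart | d.fst = .inl v}.Finite := by
  let F : G.neighborSet v × Option (Fin 2) → (triangleGraph G).Dart
    | (u, none) => baseDart ⟨(v, u), u.2⟩
    | (u, some i) => tipDart v (⟨s(v, u), u.2⟩, i) (Sym2.mem_mk_left _ _)
  refine (finite_range F).subset ?_
  rintro ⟨⟨x, y⟩, hadj⟩ (rfl : x = .inl v)
  obtain u | ⟨⟨e, he⟩, i⟩ := y
  · exact ⟨(⟨u, hadj⟩, none), rfl⟩
  · obtain ⟨u, rfl⟩ : ∃ u, e = s(v, u) := Sym2.mem_iff_exists.1 hadj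
    exact ⟨(⟨u, he⟩, some i), rfl⟩

theorem triangleGraph_le_fattening : triangleGraph G ≤ fattening Q := le_sup_left

/-- The second end-vertices of two consecutive edges at a vertex of `G` are adjacent in the
fattening: two tips by definition, an end-vertex of an edge of `G` and a tip because the tip
belongs to a square around that very edge. -/
theorem fattening_adj_of_consecutive [T2Space S] {v : V} {d d' : (triangleGraph G).Dart}
    (hd : d.fst = .inl v) (h : Q.emb.Consecutive d d') : (fattening Q).Adj d.snd d'.snd := by
  have key : ∀ {b b' : (triangleGraph G).Dart} (u : V), b.fst = .inl v → b.snd = .inl u →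
      Q.emb.Consecutive b b' → (fattening Q).Adj b.snd b'.snd := by
    rintro ⟨⟨x, y⟩, hadj⟩ b' u (rfl : x = _) (rfl : y = _) h
    obtain ⟨i, rfl⟩ := eq_tipDart_of_consecutive_baseDart Q (d := ⟨(v, u), hadj⟩) h
    exact triangleGraph_le_fattening Q (Sym2.mem_mk_right v u)
  have hd' : d'.fst = .inl v := h.1.symm.trans hd
  rcases hds : d.snd with u | t
  · rw [← hds]
    exact key u hd hds h
  rcases hds' : d'.snd with u | t'
  · rw [← hds, ← hds']
    exact (key u hd' hds' h.symm).symm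
  obtain ⟨⟨x, y⟩, hadj⟩ := d
  obtain ⟨⟨x', y'⟩, hadj'⟩ := d'
  obtain rfl : x = _ := hd
  obtain rfl : x' = _ := hd'
  obtain rfl : y = _ := hds
  obtain rfl : y' = _ := hds'
  refine Or.inr ((SimpleGraph.fromRel_adj _ _ _).2 ⟨?_, Or.inl ⟨v, t, t', hadj, hadj', rfl, rfl, h⟩⟩)
  rintro hne
  exact h.2.1 (SimpleGraph.Dart.ext _ _ (Prod.ext rfl hne))

/-- The neighbours of a vertex `v` of `G` cannot be separated from each other by removing `v` and
one of its neighbours `a`. Here `T` stands for a union of components of the fattening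
after the removal of `X`. -/
theorem mem_of_mem_neighborSet [G.LocallyFinite] [T2Space S]
    {X : Finset (V ⊕ G.edgeSet × Fin 2)} {T : Set (V ⊕ G.edgeSet × Fin 2)}
    (hT : ∀ x ∈ T, ∀ y, (fattening Q).Adj x y → y ∉ X → y ∈ T) {v : V}
    {a y z : V ⊕ G.edgeSet × Fin 2} (ha : a ∈ (triangleGraph G).neighborSet (.inl v))
    (hX : ∀ b ∈ (triangleGraph G).neighborSet (.inl v), b ∈ X → b = a)
    (hy : y ∈ (triangleGraph G).neighborSet (.inl v)) (hya : y ≠ a) (hyT : y ∈ T)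
    (hz : z ∈ (triangleGraph G).neighborSet (.inl v)) (hza : z ≠ a) : z ∈ T := by
  by_contra hzT
  have hv : Q.emb.point (.inl v) ∈ D.vertexDisc v := by
    have : g.point v ∈ D.vertexDisc v ∩ range g.point := by
      rw [D.vertexDisc_inter_points]
      rfl
    exact Q.emb_point v ▸ this.1
  let dart : ∀ x, x ∈ (triangleGraph G).neighborSet (.inl v) → (triangleGraph G).Dart :=
    fun x hx ↦ ⟨(.inl v, x), hx⟩
  obtain ⟨d, d', hd, ⟨hdT, hda⟩, hd'P, hd'a, hdd'⟩ := Q.emb.exists_consecutive_of_mem_of_notMem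
    (D.isOpenDisc_vertexDisc v) hv (finite_setOf_fst_eq_inl v) (a := dart a ha) rfl
    (P := {d | d.snd ∈ T ∧ d.snd ≠ a}) (fun h ↦ h.2 rfl) (d₀ := dart y hy) rfl ⟨hyT, hya⟩
    (d₁ := dart z hz) rfl (fun h ↦ hzT h.1) (fun h ↦ hza (congrArg (fun d ↦ d.snd) h))
  have hd' : d'.fst = .inl v := hdd'.1.symm.trans hd
  have hne : d'.snd ≠ a := fun h ↦ hd'a (SimpleGraph.Dart.ext _ _ (Prod.ext hd' h))
  have hN : d'.snd ∈ (triangleGraph G).neighborSet (.inl v) := by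
    have := d'.adj
    rwa [hd'] at this
  exact hd'P ⟨hT _ hdT _ (fattening_adj_of_consecutive Q hd hdd') fun h ↦ hne (hX _ hN h), hne⟩

/-- The two ends and the two tips of an edge of `G`. -/
def square (d : G.Dart) : Fin 4 → V ⊕ G.edgeSet × Fin 2 :=
  ![.inl d.fst, .inl d.snd, .inr (⟨d.edge, d.edge_mem⟩, 0), .inr (⟨d.edge, d.edge_mem⟩, 1)]

theorem square_injective (d : G.Dart) : Function.Injective (square d) := by
  have h := d.adj.ne
  intro i j hij
  fin_cases i <;> fin_cases j <;> simp_all [square, eq_comm]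

theorem exists_square_notMem (d : G.Dart) {X : Finset (V ⊕ G.edgeSet × Fin 2)}
    (hX : X.card < 3) : ∃ i, square d i ∉ X := by
  by_contra! h
  have := Finset.card_le_card (s := Finset.univ.map ⟨_, square_injective d⟩) (t := X) (by
    intro x hx
    obtain ⟨i, -, rfl⟩ := Finset.mem_map.1 hx
    exact h i)
  simp at this
  omega

/-- Removing at most two vertices leaves the rest of a vertex `v` of `G` and its neighbours in one
component of the fattening, as if these vertices spanned a wheel with hub `v`. -/
theorem mem_of_mem_insert_neighborSet [G.LocallyFinite] [T2Space S]
    {X : Finset (V ⊕ G.edgeSet × Fin 2)} (hX : X.card < 3) {T : Set (V ⊕ G.edgeSet × Fin 2)}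
    (hT : ∀ x ∈ T, ∀ y, (fattening Q).Adj x y → y ∉ X → y ∈ T) {v u : V} (huv : G.Adj v u)
    {y z : V ⊕ G.edgeSet × Fin 2}
    (hy : y ∈ insert (.inl v) ((triangleGraph G).neighborSet (.inl v))) (hyX : y ∉ X)
    (hyT : y ∈ T) (hz : z ∈ insert (.inl v) ((triangleGraph G).neighborSet (.inl v)))
    (hzX : z ∉ X) : z ∈ T := by
  classical
  by_cases hv : .inl v ∈ X
  · replace hy := hy.resolve_left fun h ↦ hyX (h ▸ hv)
    replace hz := hz.resolve_left fun h ↦ hzX (h ▸ hv)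
    by_cases ha : ∃ a ∈ (triangleGraph G).neighborSet (.inl v), a ∈ X
    · obtain ⟨a, ha, haX⟩ := ha
      refine mem_of_mem_neighborSet Q hT ha (fun b hb hbX ↦ ?_) hy (fun h ↦ hyX (h ▸ haX)) hyT hz
        (fun h ↦ hzX (h ▸ haX))
      by_contra hba
      have h1 : ({.inl v, a, b} : Finset (V ⊕ G.edgeSet × Fin 2)) ⊆ X := by
        simp [Finset.insert_subset_iff, hv, haX, hbX]
      have h2 := Finset.card_le_card h1
      rw [Finset.card_eq_three.2 ⟨_, _, _, (triangleGraph G).ne_of_adj ha,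
        (triangleGraph G).ne_of_adj hb, Ne.symm hba, rfl⟩] at h2
      omega
    · push Not at ha
      -- With `u` and the two tips of `vu`, there are at least three neighbours.
      obtain ⟨a, haN, hay, haz⟩ :
          ∃ a ∈ (triangleGraph G).neighborSet (.inl v), a ≠ y ∧ a ≠ z := by
        by_contra! h
        have h0 := h (.inl u) huv
        have h1 := h (.inr (⟨s(v, u), huv⟩, 0)) (Sym2.mem_mk_left _ _)
        have h2 := h (.inr (⟨s(v, u), huv⟩, 1)) (Sym2.mem_mk_left _ _)
        grind
      exact mem_of_mem_neighborSet Q hT haN (fun b hb hbX ↦ absurd hbX (ha b hb)) hy hay.symm hyT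
        hz haz.symm
  · have hvT : .inl v ∈ T := by
      obtain rfl | hy := hy
      · exact hyT
      · exact hT y hyT _ (triangleGraph_le_fattening Q hy).symm hv
    obtain rfl | hz := hz
    · exact hvT
    · exact hT _ hvT _ (triangleGraph_le_fattening Q hz) hzX

theorem square_mem_fst (d : G.Dart) (i : Fin 4) :
    square d i ∈ insert (.inl d.fst) ((triangleGraph G).neighborSet (.inl d.fst)) := by
  fin_cases i
  · exact Or.inl rfl
  · exact Or.inr d.adj
  · exact Or.inr (Sym2.mem_mk_left _ _)
  · exact Or.inr (Sym2.mem_mk_left _ _)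

theorem square_mem_snd (d : G.Dart) (i : Fin 4) :
    square d i ∈ insert (.inl d.snd) ((triangleGraph G).neighborSet (.inl d.snd)) := by
  fin_cases i
  · exact Or.inr d.adj.symm
  · exact Or.inl rfl
  · exact Or.inr (Sym2.mem_mk_right _ _)
  · exact Or.inr (Sym2.mem_mk_right _ _)

theorem exists_mem_insert_neighborSet (x : V ⊕ G.edgeSet × Fin 2) :
    ∃ v, x ∈ insert (.inl v) ((triangleGraph G).neighborSet (.inl v)) := by
  obtain v | ⟨⟨e, he⟩, i⟩ := x
  · exact ⟨v, Or.inl rfl⟩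
  · induction e with
    | _ a b => exact ⟨a, Or.inr (Sym2.mem_mk_left a b)⟩

end Fattening

end SurfaceGraph

theorem mainTheorem8 {V : Type*} (G : SimpleGraph V) [G.LocallyFinite] (hG : G.Connected)
    (hV : Nontrivial V)
    {S : Type*} [TopologicalSpace S] [T2Space S] [ChartedSpace (EuclideanSpace ℝ (Fin 2)) S]
    (g : SurfaceGraph.Embedding G S) (D : SurfaceGraph.Generosity g)
    (Q : SurfaceGraph.SquareDrawing D) :
    SurfaceGraph.IsKConnected 3 (SurfaceGraph.fattening Q) := by
  have hadj : ∀ v, ∃ u, G.Adj v u := hG.preconnected.exists_adj_of_nontrivial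
  obtain ⟨v₀⟩ := hG.nonempty
  obtain ⟨u₀, hu₀⟩ := hadj v₀
  refine ⟨?_, fun X hX ↦ ?_⟩
  · have h := ENat.card_le_card_of_injective (SurfaceGraph.square_injective ⟨(v₀, u₀), hu₀⟩)
    rw [ENat.card_eq_coe_fintype_card, Fintype.card_fin] at h
    exact lt_of_lt_of_le (by norm_num) h
  obtain ⟨i₀, hi₀⟩ := SurfaceGraph.exists_square_notMem ⟨(v₀, u₀), hu₀⟩ hX
  refine (SimpleGraph.connected_iff _).2 ⟨?_, ⟨_, hi₀⟩⟩
  rintro ⟨y, hy⟩ ⟨z, hz⟩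
  let T : Set (V ⊕ G.edgeSet × Fin 2) := {w | ∃ h : w ∉ X,
    ((SurfaceGraph.fattening Q).induce {w | w ∉ X}).Reachable ⟨y, hy⟩ ⟨w, h⟩}
  have hT : ∀ x ∈ T, ∀ w, (SurfaceGraph.fattening Q).Adj x w → w ∉ X → w ∈ T := by
    rintro x ⟨hx, hyx⟩ w hxw hw
    refine ⟨hw, hyx.trans (SimpleGraph.Adj.reachable ?_)⟩
    exact hxw
  have hyT : y ∈ T := ⟨hy, .refl _⟩
  suffices z ∈ T from this.2
  obtain ⟨v, hv⟩ := SurfaceGraph.exists_mem_insert_neighborSet y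
  obtain ⟨w, hw⟩ := SurfaceGraph.exists_mem_insert_neighborSet z
  -- The wheels at adjacent vertices of `G` share the square between them, and at least two of its
  -- four vertices are not in `X`. So the component `T` spreads along a walk from `v` to `w`.
  obtain ⟨p⟩ := hG.preconnected v w
  have key : ∃ x ∈ insert (.inl w) ((SurfaceGraph.triangleGraph G).neighborSet (.inl w)),
      x ∉ X ∧ x ∈ T := by
    clear hw
    replace hv : ∃ x ∈ insert (.inl v) ((SurfaceGraph.triangleGraph G).neighborSet (.inl v)),
      x ∉ X ∧ x ∈ T := ⟨y, hv, hy, hyT⟩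
    induction p with
    | nil => exact hv
    | @cons a b c h p ih =>
      refine ih ?_
      obtain ⟨x, hx, hxX, hxT⟩ := hv
      obtain ⟨i, hi⟩ := SurfaceGraph.exists_square_notMem ⟨(a, b), h⟩ hX
      exact ⟨_, SurfaceGraph.square_mem_snd ⟨(a, b), h⟩ i, hi,
        SurfaceGraph.mem_of_mem_insert_neighborSet Q hX hT h hx hxX hxT
          (SurfaceGraph.square_mem_fst ⟨(a, b), h⟩ i) hi⟩
  obtain ⟨x, hx, hxX, hxT⟩ := key
  obtain ⟨u, hu⟩ := hadj w
  exact SurfaceGraph.mem_of_mem_insert_neighborSet Q hX hT hu hx hxX hxT hw hz
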